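/- Let $X$ be a compact Hausdorff space whose weight $w(X)$ is a regular cardinal, where $w(X)$ is the least infinite cardinal $\kappa$ such that $X$ has a base of cardinality at most $\kappa$. For a base $\mathcal B$ of a topological space, the Noetherian type of $\mathcal B$ is the least infinite cardinal $\kappa$ such that every $U\in\mathcal B$ has fewer than $\kappa$ supersets in $\mathcal B$; the Noetherian type $\mathrm{Nt}(Y)$ of a space $Y$ is the least Noetherian type of a base of $Y$. Let $I=[0,1]$, and let $\beta\omega$ be the Stone–Čech compactification of the countably infinite discrete space. (a) If there is no continuous surjection from $X$ onto the Tychonoff cube $I^{w(X)}$, then $\mathrm{Nt}(X^n)=\mathrm{Nt}(X)$ for every integer $n\ge 1$. (b) If at least one of the following conditions holds, then $\mathrm{Nt}(X^n)=\mathrm{Nt}(X)$ for every integer $n\ge 1$: (1) $X$ is hereditarily normal (every subspace of $X$ is normal); (2) $\beta\omega$ does not embed in $X$; (3) $|X|<2^{w(X)}$. -/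

import Mathlib

open Cardinal TopologicalSpace

/-- A poset `P` is `κ^op`-like if every element of `P` has fewer than `κ` elements above it
(itself included). -/
def IsOpLike (P : Type*) [LE P] (κ : Cardinal) : Prop :=
  ∀ p : P, #{x : P // p ≤ x} < κ

/-- The op-character of a poset: the least infinite `κ` for which it is `κ^op`-like. -/
noncomputable def opCharacter (P : Type*) [LE P] : Cardinal :=
  sInf {κ | ℵ₀ ≤ κ ∧ IsOpLike P κ}

/-- The Noetherian type of a topological space: the least op-character of a base. A base `B` is
ordered by inclusion (the order that `↥B` inherits from `Set X`), so that being `κ^op`-like means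
that every member of `B` has fewer than `κ` supersets in `B`. -/
noncomputable def noetherianType (X : Type*) [TopologicalSpace X] : Cardinal :=
  sInf {κ | ∃ B : Set (Set X), IsTopologicalBasis B ∧ κ = opCharacter B}

/-- The weight of a topological space: the least cardinality of a base, or `ℵ₀` if that
cardinality is finite (cardinal functions take infinite values). -/
noncomputable def topWeight (X : Type*) [TopologicalSpace X] : Cardinal :=
  max ℵ₀ (sInf {κ | ∃ B : Set (Set X), IsTopologicalBasis B ∧ κ = #B})

/-- `X` maps onto the Tychonoff cube `I^κ`: there is a continuous surjection of `X` onto the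
product of `κ` copies of the unit interval. -/
def MapsOntoCube (X : Type*) [TopologicalSpace X] (κ : Cardinal) : Prop :=
  ∃ f : X → (κ.out → unitInterval), Continuous f ∧ Function.Surjective f

/-- Every subspace is normal (for Hausdorff spaces this is the usual notion). -/
def HereditarilyNormal (X : Type*) [TopologicalSpace X] : Prop :=
  ∀ s : Set X, NormalSpace s

/-- `X` contains a copy of `βω`, the Stone-Čech compactification of the discrete space `ℕ`. -/
def ContainsBetaOmega (X : Type*) [TopologicalSpace X] : Prop :=
  ∃ f : StoneCech ℕ → X, Topology.IsEmbedding f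

/-! Finite powers of any compact Hausdorff space preserve the Noetherian type. For `≤`, boxes over
an optimal base of `X` work. For `≥`, start from an optimal base `C` of the power and its diagonal
`δ`. It suffices to find a base of `X` whose members `q` (isolated singletons aside) carry labels `e
∈ C` with `q^ι ⊆ e`, each label being used finitely often. If `c ∈ C` satisfies `c ⊆ q^ι`, every
superset of `q` has a label containing `c`, so there are too few labels for too many supersets. Such
a labelling is the supply of `hasSupply`: compactness treats finite subfamilies, and induction on
cardinality glues stages, each using only labels absent from the earlier ones. -/

open Set

/-! ### Labelled neighbourhoods: finite and countable families -/

section Supply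

variable {Y Z : Type*} [TopologicalSpace Z]

/-- Some pair `a' ⊆ closure a' ⊆ a` of open members of `S` interpolates between the point `δ p`
and the set `c`. -/
def Interpolates (δ : Y → Z) (S : Set (Set Z)) (p : Y) (c : Set Z) : Prop :=
  ∃ a' ∈ S, ∃ a ∈ S, IsOpen a' ∧ IsOpen a ∧ δ p ∈ a' ∧ closure a' ⊆ a ∧ a ⊆ c

theorem Interpolates.mono_right {δ : Y → Z} {S : Set (Set Z)} {p : Y} {c d : Set Z}
    (h : Interpolates δ S p c) (hcd : c ⊆ d) : Interpolates δ S p d := by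
  obtain ⟨a', ha', a, ha, h1, h2, h3, h4, h5⟩ := h
  exact ⟨a', ha', a, ha, h1, h2, h3, h4, h5.trans hcd⟩

/-- Shrink neighbourhoods in `C` infinitely often, each closure inside the previous set. By
pigeonhole two of them lie in the same `N`, and these interpolate. -/
theorem exists_interpolates_of_forall_mem [RegularSpace Z] {C : Set (Set Z)}
    (hC : IsTopologicalBasis C) {δ : Y → Z} {𝓝 : Set (Set (Set Z))} (h𝓝 : 𝓝.Finite) {p : Y}
    {W : Set Z} (hW : IsOpen W) (hp : δ p ∈ W)
    (h : ∀ e ∈ C, δ p ∈ e → e ⊆ W → ∃ N ∈ 𝓝, e ∈ N) : ∃ N ∈ 𝓝, Interpolates δ N p W := by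
  have step : ∀ V : {V : Set Z // IsOpen V ∧ δ p ∈ V}, ∃ e : {V : Set Z // IsOpen V ∧ δ p ∈ V},
      e.1 ∈ C ∧ closure e.1 ⊆ V.1 := by
    rintro ⟨V, hV, hpV⟩
    obtain ⟨e, he, hpe, hcl⟩ := hC.exists_closure_subset (hV.mem_nhds hpV)
    exact ⟨⟨e, hC.isOpen he, hpe⟩, he, hcl⟩
  choose g hgC hg using step
  let s : ℕ → {V : Set Z // IsOpen V ∧ δ p ∈ V} := fun n => g^[n] ⟨W, hW, hp⟩
  have hs : ∀ n, s (n + 1) = g (s n) := fun n => Function.iterate_succ_apply' g n _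
  have hanti : Antitone fun n => (s n).1 := antitone_nat_of_succ_le fun n => by
    rw [hs]; exact subset_closure.trans (hg _)
  have hmem : ∀ n, ∃ N : 𝓝, (s (n + 1)).1 ∈ N.1 := fun n => by
    obtain ⟨N, hN, hmem⟩ := h (s (n + 1)).1 (by rw [hs]; exact hgC _) (s (n + 1)).2.2
      (hanti (Nat.zero_le (n + 1)))
    exact ⟨⟨N, hN⟩, hmem⟩
  choose f hf using hmem
  have := h𝓝.to_subtype
  obtain ⟨i, j, hne, hij⟩ := Finite.exists_ne_map_eq_of_infinite f
  wlog hlt : i < j generalizing i j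
  · exact this j i hne.symm hij.symm (by omega)
  refine ⟨f i, (f i).2, (s (j + 1)).1, hij ▸ hf j, (s (i + 1)).1, hf i, (s (j + 1)).2.1,
    (s (i + 1)).2.1, (s (j + 1)).2.2, ?_, hanti (Nat.zero_le (i + 1))⟩
  rw [hs j]
  exact (hg _).trans (hanti hlt)

theorem exists_mem_basis_avoiding [RegularSpace Z] [T1Space Z] {C : Set (Set Z)}
    (hC : IsTopologicalBasis C) {δ : Y → Z} {𝓝 : Set (Set (Set Z))} (h𝓝 : 𝓝.Finite)
    {G : Set (Set Z)} (hG : G.Finite) {p : Y} (hp : ¬ IsOpen {δ p}) {c : Set Z} (hc : IsOpen c)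
    (hpc : δ p ∈ c) (hN : ∀ N ∈ 𝓝, ¬ Interpolates δ N p c) :
    ∃ e ∈ C, δ p ∈ e ∧ e ⊆ c ∧ e ∉ G ∧ ∀ N ∈ 𝓝, e ∉ N := by
  have hz : ∀ g : Set Z, ∃ z, z ≠ δ p ∧ (IsOpen g → δ p ∈ g → z ∈ g) := by
    intro g
    have hne : ∃ z, z ≠ δ p := by
      by_contra! h
      apply hp
      rw [show ({δ p} : Set Z) = Set.univ from eq_univ_of_forall h]
      exact isOpen_univ
    by_cases hg : IsOpen g ∧ δ p ∈ g
    · by_contra! h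
      have : g = {δ p} := by
        refine Subset.antisymm (fun z hz => ?_) (by simpa using hg.2)
        by_contra hzp
        exact (h z hzp).2.2 hz
      exact hp (this ▸ hg.1)
    · obtain ⟨z, hz⟩ := hne
      exact ⟨z, hz, fun h1 h2 => absurd ⟨h1, h2⟩ hg⟩
  choose z hzp hzg using hz
  -- Removing from `c` one point other than `δ p` of each neighbourhood in `G` prevents any
  -- neighbourhood of `δ p` inside `W` from belonging to `G`.
  let W := c \ z '' G
  have hW : IsOpen W := hc.sdiff (hG.image z).isClosed
  have hpW : δ p ∈ W := ⟨hpc, by rintro ⟨g, -, hg⟩; exact hzp g hg⟩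
  by_contra! hcon
  obtain ⟨N, hNN, hI⟩ := exists_interpolates_of_forall_mem hC h𝓝 hW hpW fun e he hpe heW =>
    hcon e he hpe (heW.trans sdiff_subset) fun heG =>
      (heW (hzg e (hC.isOpen he) hpe)).2 (mem_image_of_mem z heG)
  exact hN N hNN (hI.mono_right sdiff_subset)

variable [TopologicalSpace Y]

/-- A set `Q` of pairs `(q, e)` serves `S` modulo `𝓝`: at every nonisolated point at which `S`
interpolates below `c`, either some member of `𝓝` interpolates below `c` as well, or the point
lies in some `q` with `(q, e) ∈ Q` and `e ⊆ c`. -/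
def Serves (δ : Y → Z) (𝓝 : Set (Set (Set Z))) (Q : Set (Set Y × Set Z)) (S : Set (Set Z)) :
    Prop :=
  ∀ p, ¬ IsOpen {δ p} → ∀ c, Interpolates δ S p c →
    (∃ N ∈ 𝓝, Interpolates δ N p c) ∨ ∃ x ∈ Q, p ∈ x.1 ∧ x.2 ⊆ c

/-- `x = (q, e)` is a pair of an open set `q` and a member `e` of `C` outside all members of `𝓝`
such that `r q e`. -/
def Admissible (r : Set Y → Set Z → Prop) (C : Set (Set Z)) (𝓝 : Set (Set (Set Z)))
    (x : Set Y × Set Z) : Prop :=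
  x.2 ∈ C ∧ (∀ N ∈ 𝓝, x.2 ∉ N) ∧ IsOpen x.1 ∧ r x.1 x.2

/-- The family `S₀` extends, without increasing its (infinite) cardinality, to a family `S` that is
served modulo `𝓝` by admissible pairs with second component in `S`, finitely many for each
second component. -/
def HasSupply (δ : Y → Z) (r : Set Y → Set Z → Prop) (C S₀ : Set (Set Z))
    (𝓝 : Set (Set (Set Z))) : Prop :=
  ∃ S, S₀ ⊆ S ∧ #S ≤ max #S₀ ℵ₀ ∧ ∃ Q : Set (Set Y × Set Z),
    (∀ x ∈ Q, x.2 ∈ S ∧ Admissible r C 𝓝 x) ∧ (∀ e, {q | (q, e) ∈ Q}.Finite) ∧ Serves δ 𝓝 Q S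

variable [CompactSpace Y] [RegularSpace Z] [T1Space Z] {C : Set (Set Z)} {δ : Y → Z}
  {r : Set Y → Set Z → Prop}

theorem exists_finite_pairs (hC : IsTopologicalBasis C) (hδ : Continuous δ)
    (hr : ∀ e, IsOpen e → ∀ p, δ p ∈ e → ∃ q, IsOpen q ∧ p ∈ q ∧ r q e)
    {𝓝 : Set (Set (Set Z))} (h𝓝 : 𝓝.Finite) {G : Set (Set Z)} (hG : G.Finite) {c' c : Set Z}
    (hc : IsOpen c) (hcc : closure c' ⊆ c) :
    ∃ Q : Set (Set Y × Set Z), Q.Finite ∧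
      (∀ x ∈ Q, x.2 ∉ G ∧ x.2 ⊆ c ∧ Admissible r C 𝓝 x) ∧
      ∀ p, ¬ IsOpen {δ p} → δ p ∈ c' →
        (∃ N ∈ 𝓝, Interpolates δ N p c) ∨ ∃ x ∈ Q, p ∈ x.1 := by
  -- The points still to be covered. Interpolation by `𝓝` and isolation are open conditions, so `R`
  -- is compact.
  let R : Set Y := δ ⁻¹' closure c' ∩ {p | ¬ IsOpen {δ p}} ∩
    {p | ¬ ∃ N ∈ 𝓝, Interpolates δ N p c}
  have h1 : IsClosed {p | ¬ IsOpen ({δ p} : Set Z)} := by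
    have : IsOpen {z : Z | IsOpen ({z} : Set Z)} := by
      rw [isOpen_iff_forall_mem_open]
      intro z hz
      exact ⟨{z}, by rintro _ rfl; exact hz, hz, rfl⟩
    exact (this.preimage hδ).isClosed_compl
  have h2 : IsClosed {p | ¬ ∃ N ∈ 𝓝, Interpolates δ N p c} := by
    have : IsOpen {p | ∃ N ∈ 𝓝, Interpolates δ N p c} := by
      rw [isOpen_iff_forall_mem_open]
      rintro p ⟨N, hN, a', ha', a, ha, o1, o2, hpa, h⟩
      exact ⟨δ ⁻¹' a', fun q hq => ⟨N, hN, a', ha', a, ha, o1, o2, hq, h⟩, o1.preimage hδ, hpa⟩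
    exact this.isClosed_compl
  have hR : IsCompact R := (((isClosed_closure.preimage hδ).inter h1).inter h2).isCompact
  have key : ∀ p : R, ∃ x : Set Y × Set Z, p.1 ∈ x.1 ∧ x.2 ∉ G ∧ x.2 ⊆ c ∧ Admissible r C 𝓝 x := by
    rintro ⟨p, ⟨hpc, hp⟩, hpN⟩
    obtain ⟨e, heC, hpe, hec, heG, heN⟩ := exists_mem_basis_avoiding hC h𝓝 hG hp hc (hcc hpc)
      fun N hN hI => hpN ⟨N, hN, hI⟩
    obtain ⟨q, hq, hpq, hre⟩ := hr e (hC.isOpen heC) p hpe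
    exact ⟨(q, e), hpq, heG, hec, heC, heN, hq, hre⟩
  choose x hpx hx using key
  obtain ⟨t, ht⟩ := hR.elim_finite_subcover (fun p => (x p).1) (fun p => (hx p).2.2.2.2.1)
    fun p hp => mem_iUnion.2 ⟨⟨p, hp⟩, hpx ⟨p, hp⟩⟩
  refine ⟨x '' t, t.finite_toSet.image x, ?_, fun p hp hpc => ?_⟩
  · rintro _ ⟨p, -, rfl⟩
    exact hx p
  · by_cases h : ∃ N ∈ 𝓝, Interpolates δ N p c
    · exact Or.inl h
    · obtain ⟨i, hi, hpi⟩ := mem_iUnion₂.1 (ht ⟨⟨subset_closure hpc, hp⟩, h⟩)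
      exact Or.inr ⟨x i, mem_image_of_mem x hi, hpi⟩

theorem exists_finite_serves (hC : IsTopologicalBasis C) (hδ : Continuous δ)
    (hr : ∀ e, IsOpen e → ∀ p, δ p ∈ e → ∃ q, IsOpen q ∧ p ∈ q ∧ r q e)
    {𝓝 : Set (Set (Set Z))} (h𝓝 : 𝓝.Finite) {T : Set (Set Z)} (hT : T.Finite) :
    ∃ Q : Set (Set Y × Set Z), Q.Finite ∧ (∀ x ∈ Q, x.2 ∉ T ∧ Admissible r C 𝓝 x) ∧
      Serves δ 𝓝 Q T := by
  have key : ∀ d : Set Z × Set Z, ∃ Q : Set (Set Y × Set Z), Q.Finite ∧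
      (∀ x ∈ Q, x.2 ∉ T ∧ Admissible r C 𝓝 x) ∧
      (IsOpen d.2 → closure d.1 ⊆ d.2 → ∀ p, ¬ IsOpen {δ p} → δ p ∈ d.1 →
        (∃ N ∈ 𝓝, Interpolates δ N p d.2) ∨ ∃ x ∈ Q, p ∈ x.1 ∧ x.2 ⊆ d.2) := by
    rintro ⟨c', c⟩
    by_cases h : IsOpen c ∧ closure c' ⊆ c
    · obtain ⟨Q, hQ, hx, hs⟩ := exists_finite_pairs (r := r) hC hδ hr h𝓝 hT h.1 h.2
      refine ⟨Q, hQ, fun x hxQ => ⟨(hx x hxQ).1, (hx x hxQ).2.2⟩, fun _ _ p hp hpc => ?_⟩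
      exact (hs p hp hpc).imp_right fun ⟨x, hxQ, hpx⟩ => ⟨x, hxQ, hpx, (hx x hxQ).2.1⟩
    · exact ⟨∅, finite_empty, by simp, fun h1 h2 => absurd ⟨h1, h2⟩ h⟩
  choose Q hQ hx hs using key
  refine ⟨⋃ d ∈ T ×ˢ T, Q d, (hT.prod hT).biUnion fun d _ => hQ d, fun x hxQ => ?_, ?_⟩
  · obtain ⟨d, -, hd⟩ := mem_iUnion₂.1 hxQ
    exact hx d x hd
  · rintro p hp c ⟨a', ha', a, ha, o1, o2, hpa, hcl, hac⟩
    rcases hs (a', a) o2 hcl p hp hpa with ⟨N, hN, hI⟩ | ⟨x, hxQ, hpx, hxa⟩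
    · exact Or.inl ⟨N, hN, hI.mono_right hac⟩
    · exact Or.inr ⟨x, mem_iUnion₂.2 ⟨(a', a), ⟨ha', ha⟩, hxQ⟩, hpx, hxa.trans hac⟩

/-- Exhaust by finite sets `T n`, each absorbing the labels chosen for the previous one. Labels for
`T n` avoid `T n`, so a label occurs at one stage only. -/
theorem hasSupply_of_countable (hC : IsTopologicalBasis C) (hδ : Continuous δ)
    (hr : ∀ e, IsOpen e → ∀ p, δ p ∈ e → ∃ q, IsOpen q ∧ p ∈ q ∧ r q e)
    {𝓝 : Set (Set (Set Z))} (h𝓝 : 𝓝.Finite) {S₀ : Set (Set Z)} (hS₀ : S₀.Countable) :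
    HasSupply δ r C S₀ 𝓝 := by
  obtain ⟨d, hd⟩ := countable_iff_exists_subset_range.1 hS₀
  choose Q hQ hx hs using fun T : {T : Set (Set Z) // T.Finite} =>
    exists_finite_serves (r := r) hC hδ hr h𝓝 T.2
  let next : ℕ → {T : Set (Set Z) // T.Finite} → {T : Set (Set Z) // T.Finite} := fun n T =>
    ⟨insert (d n) (T.1 ∪ Prod.snd '' Q T), (T.2.union ((hQ T).image _)).insert _⟩
  let T : ℕ → {T : Set (Set Z) // T.Finite} := fun n => Nat.rec ⟨∅, finite_empty⟩ next n
  have hTsucc : ∀ n, (T (n + 1)).1 = insert (d n) ((T n).1 ∪ Prod.snd '' Q (T n)) := fun _ => rfl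
  have hmono : Monotone fun n => (T n).1 := monotone_nat_of_le_succ fun n => by
    rw [hTsucc]; exact subset_union_left.trans (subset_insert _ _)
  have hQT : ∀ {n x}, x ∈ Q (T n) → x.2 ∈ (T (n + 1)).1 := fun {n x} h => by
    rw [hTsucc]; exact Or.inr (Or.inr ⟨x, h, rfl⟩)
  refine ⟨⋃ n, (T n).1, fun e he => ?_, ?_, ⋃ n, Q (T n), fun x h => ?_, fun e => ?_, ?_⟩
  · obtain ⟨n, rfl⟩ := hd he
    exact mem_iUnion.2 ⟨n + 1, by rw [hTsucc]; exact Or.inl rfl⟩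
  · exact (le_aleph0_iff_set_countable.2 (countable_iUnion fun n => (T n).2.countable)).trans
      (le_max_right _ _)
  · obtain ⟨n, hn⟩ := mem_iUnion.1 h
    exact ⟨mem_iUnion.2 ⟨n + 1, hQT hn⟩, (hx (T n) x hn).2⟩
  · by_cases h : ∃ n q, (q, e) ∈ Q (T n)
    · obtain ⟨n, q, hn⟩ := h
      refine ((hQ (T n)).image Prod.fst).subset fun q' hq' => ?_
      obtain ⟨m, hm⟩ := mem_iUnion.1 hq'
      obtain hlt | rfl | hlt := lt_trichotomy m n
      · exact absurd (hmono hlt (hQT hm)) (hx _ _ hn).1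
      · exact ⟨_, hm, rfl⟩
      · exact absurd (hmono hlt (hQT hn)) (hx _ _ hm).1
    · push Not at h
      refine finite_empty.subset fun q hq => ?_
      obtain ⟨n, hn⟩ := mem_iUnion.1 hq
      exact h n q hn
  · rintro p hp c ⟨a', ha', a, ha, h⟩
    obtain ⟨i, hi⟩ := mem_iUnion.1 ha'
    obtain ⟨j, hj⟩ := mem_iUnion.1 ha
    refine (hs (T (max i j)) p hp c ⟨a', hmono (le_max_left i j) hi, a,
      hmono (le_max_right i j) hj, h⟩).imp_right ?_
    rintro ⟨x, hx, h⟩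
    exact ⟨x, mem_iUnion.2 ⟨_, hx⟩, h⟩

end Supply

-- Transfinite construction of supplies

universe u in
theorem mk_iUnion_le_of_le {α ι : Type u} {f : ι → Set α} {κ : Cardinal.{u}} (hκ : ℵ₀ ≤ κ)
    (hι : #ι ≤ κ) (hf : ∀ i, #(f i) ≤ κ) : #(⋃ i, f i) ≤ κ :=
  (mk_iUnion_le f).trans <| (mul_le_mul' hι (ciSup_le' hf)).trans (mul_eq_self hκ).le

/-- Every family has a supply, by induction on its cardinality: a countable family is exhausted by
finite ones, an uncountable one by a continuous chain of families of smaller cardinality, each of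
which is added to `𝓝` at its own stage. -/
theorem hasSupply {Y : Type*} {Z : Type*} [TopologicalSpace Y] [CompactSpace Y]
    [TopologicalSpace Z] [RegularSpace Z] [T1Space Z] {C : Set (Set Z)} {δ : Y → Z}
    {r : Set Y → Set Z → Prop} (hC : IsTopologicalBasis C) (hδ : Continuous δ)
    (hr : ∀ e, IsOpen e → ∀ p, δ p ∈ e → ∃ q, IsOpen q ∧ p ∈ q ∧ r q e)
    (S₀ : Set (Set Z)) {𝓝 : Set (Set (Set Z))} (h𝓝 : 𝓝.Finite) : HasSupply δ r C S₀ 𝓝 := by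
  induction hμ : #S₀ using WellFoundedLT.induction generalizing S₀ 𝓝 with
  | ind μ ih =>
  subst hμ
  rcases le_or_gt #S₀ ℵ₀ with hcount | hunc
  · exact hasSupply_of_countable hC hδ hr h𝓝 (le_aleph0_iff_set_countable.1 hcount)
  replace ih : ∀ S : Set (Set Z), #S < #S₀ → ∀ N : Set (Set Z),
      HasSupply δ r C S (insert N 𝓝) := fun S hS N => ih #S hS S (h𝓝.insert N) rfl
  let ι := (#S₀).ord.ToType
  have hι : #ι = #S₀ := by simp [ι]
  obtain ⟨d⟩ : Nonempty (ι ≃ S₀) := Cardinal.eq.1 hι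
  have hlim : ∀ i : ι, #(Iio i) < #S₀ := fun i => by
    have := mk_Iio_lt i (by rw [hι]; simp [ι])
    rwa [hι] at this
  choose Φ hΦ using fun (N S : Set (Set Z)) (h : HasSupply δ r C S (insert N 𝓝)) => h
  -- `U i` is the extension of `insert (d i) (⋃ j < i, U j)` by its supply.
  classical
  let next : ι → Set (Set Z) → Set (Set Z) := fun i T =>
    if h : HasSupply δ r C (insert (d i).1 T) (insert T 𝓝) then Φ _ _ h else ∅
  let U : ι → Set (Set Z) := WellFoundedLT.fix fun i V => next i (⋃ j : Iio i, V j.1 j.2)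
  let T : ι → Set (Set Z) := fun i => ⋃ j : Iio i, U j
  have hU : ∀ i, U i = next i (T i) := fun i => WellFoundedLT.fix_eq _ _
  have hUT : ∀ {i j}, i < j → U i ⊆ T j := fun {i j} hij => subset_iUnion_of_subset ⟨i, hij⟩ subset_rfl
  -- Proved jointly: the bounds on earlier stages make the outer induction applicable at `i`, so the
  -- default `∅` never occurs.
  have hcard : ∀ i, HasSupply δ r C (insert (d i).1 (T i)) (insert (T i) 𝓝) ∧
      #(U i) ≤ max #(Iio i) ℵ₀ := by
    intro i
    induction i using WellFoundedLT.induction with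
    | ind i ihi =>
    have hT : #(T i) ≤ max #(Iio i) ℵ₀ := 
      mk_iUnion_le_of_le (le_max_right _ _) (le_max_left _ _) fun j => (ihi j.1 j.2).2.trans <|
        max_le_max_right _ <| mk_le_mk_of_subset <| Iio_subset_Iio <| le_of_lt j.2
    have hins : #(insert (d i).1 (T i) : Set (Set Z)) ≤ max #(Iio i) ℵ₀ :=
      (mk_insert_le).trans (add_le_of_le (le_max_right _ _) hT
        (one_le_aleph0.trans (le_max_right _ _)))
    have hs := ih _ (hins.trans_lt (max_lt (hlim i) hunc)) (T i)
    refine ⟨hs, ?_⟩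
    rw [hU]
    simp only [next, dif_pos hs]
    exact (hΦ _ _ hs).2.1.trans (max_le hins (le_max_right _ _))
  have hs := fun i => (hcard i).1
  have hUΦ : ∀ i, U i = Φ _ _ (hs i) := fun i => by
    refine (hU i).trans ?_
    simp only [next, dif_pos (hs i)]
  have hsub : ∀ i, insert (d i).1 (T i) ⊆ U i := fun i => by
    rw [hUΦ]; exact (hΦ _ _ (hs i)).1
  have hQex : ∀ i, ∃ Q : Set (Set Y × Set Z),
      (∀ x ∈ Q, x.2 ∈ U i ∧ Admissible r C (insert (T i) 𝓝) x) ∧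
      (∀ e, {q | (q, e) ∈ Q}.Finite) ∧ Serves δ (insert (T i) 𝓝) Q (U i) := fun i => by
    rw [hUΦ]; exact (hΦ _ _ (hs i)).2.2
  choose Q hQ hfin hserves using hQex
  have hmono : Monotone U := fun i j hij => by
    rcases hij.eq_or_lt with rfl | hlt
    · exact subset_rfl
    · exact (hUT hlt).trans ((subset_insert _ _).trans (hsub j))
  refine ⟨⋃ i, U i, fun e he => ?_, ?_, ⋃ i, Q i, fun x h => ?_, fun e => ?_, ?_⟩
  · exact mem_iUnion.2 ⟨d.symm ⟨e, he⟩, hsub _ (Or.inl (by simp))⟩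
  · exact mk_iUnion_le_of_le (le_max_right _ _) (hι.le.trans (le_max_left _ _)) fun i =>
      (hcard i).2.trans (max_le_max_right _ (hlim i).le)
  · obtain ⟨i, hi⟩ := mem_iUnion.1 h
    obtain ⟨h1, h2, h3, h4⟩ := hQ i x hi
    exact ⟨mem_iUnion.2 ⟨i, h1⟩, h2, fun N hN => h3 N (mem_insert_of_mem _ hN), h4⟩
  · have hnot : ∀ {i j q q'}, (q, e) ∈ Q i → (q', e) ∈ Q j → ¬ i < j :=
      fun hx hy hij => (hQ _ _ hy).2.2.1 _ (mem_insert _ _) (hUT hij (hQ _ _ hx).1)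
    by_cases h : ∃ i q, (q, e) ∈ Q i
    · obtain ⟨i, q, hi⟩ := h
      refine (hfin i e).subset fun q' hq' => ?_
      obtain ⟨j, hj⟩ := mem_iUnion.1 hq'
      obtain hlt | rfl | hlt := lt_trichotomy i j
      · exact absurd hlt (hnot hi hj)
      · exact hj
      · exact absurd hlt (hnot hj hi)
    · push Not at h
      refine finite_empty.subset fun q hq => ?_
      obtain ⟨i, hi⟩ := mem_iUnion.1 hq
      exact h i q hi
  · intro p hp
    -- If stage `i` defers to `T i`, the two interpolating sets already lie in a common earlier `U
    -- j`; well-foundedness ends the descent.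
    have key : ∀ i c, Interpolates δ (U i) p c →
        (∃ N ∈ 𝓝, Interpolates δ N p c) ∨ ∃ x ∈ ⋃ i, Q i, p ∈ x.1 ∧ x.2 ⊆ c := by
      intro i
      induction i using WellFoundedLT.induction with
      | ind i ihi =>
      intro c hI
      rcases hserves i p hp c hI with ⟨N, rfl | hN, hNI⟩ | ⟨x, hx, h⟩
      · obtain ⟨a', ha', a, ha, h⟩ := hNI
        obtain ⟨j, hj⟩ := mem_iUnion.1 ha'
        obtain ⟨k, hk⟩ := mem_iUnion.1 ha
        exact ihi (max j.1 k.1) (max_lt j.2 k.2) c ⟨a', hmono (le_max_left _ _) hj, a,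
          hmono (le_max_right _ _) hk, h⟩
      · exact Or.inl ⟨N, hN, hNI⟩
      · exact Or.inr ⟨x, mem_iUnion.2 ⟨i, hx⟩, h⟩
    rintro c ⟨a', ha', a, ha, h⟩
    obtain ⟨i, hi⟩ := mem_iUnion.1 ha'
    obtain ⟨j, hj⟩ := mem_iUnion.1 ha
    exact key (max i j) c ⟨a', hmono (le_max_left _ _) hi, a, hmono (le_max_right _ _) hj, h⟩

/-! ### Comparing bases of a space and its powers -/

section NoetherianType

variable {X : Type*}

theorem exists_isOpLike_opCharacter (P : Type*) [LE P] :
    ℵ₀ ≤ opCharacter P ∧ IsOpLike P (opCharacter P) := by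
  refine csInf_mem (s := {κ | ℵ₀ ≤ κ ∧ IsOpLike P κ})
    ⟨Order.succ (max ℵ₀ #P), (le_max_left _ _).trans (Order.le_succ _), fun p => ?_⟩
  exact Order.lt_succ_of_le ((mk_subtype_le _).trans (le_max_right _ _))

theorem exists_basis_isOpLike_noetherianType (X : Type*) [TopologicalSpace X] :
    ∃ B : Set (Set X), IsTopologicalBasis B ∧ ℵ₀ ≤ noetherianType X ∧
      IsOpLike B (noetherianType X) := by
  obtain ⟨B, hB, h⟩ := csInf_mem (s := {κ | ∃ B : Set (Set X), IsTopologicalBasis B ∧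
    κ = opCharacter B}) ⟨_, _, isTopologicalBasis_opens, rfl⟩
  have hκ : noetherianType X = opCharacter B := h
  exact ⟨B, hB, hκ ▸ exists_isOpLike_opCharacter B⟩

theorem noetherianType_le [TopologicalSpace X] {B : Set (Set X)} (hB : IsTopologicalBasis B)
    {κ : Cardinal} (hκ : ℵ₀ ≤ κ) (h : ∀ U ∈ B, #{V // V ∈ B ∧ U ⊆ V} < κ) :
    noetherianType X ≤ κ := by
  have hlike : IsOpLike B κ := fun U => ?_
  · exact (csInf_le' (s := {κ | ∃ B : Set (Set X), IsTopologicalBasis B ∧ κ = opCharacter B})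
      ⟨B, hB, rfl⟩).trans (csInf_le' (s := {κ | ℵ₀ ≤ κ ∧ IsOpLike B κ}) ⟨hκ, hlike⟩)
  refine lt_of_le_of_lt (mk_le_of_injective (f := fun V : {V : B // U ≤ V} =>
    (⟨V.1.1, V.1.2, V.2⟩ : {V // V ∈ B ∧ U.1 ⊆ V})) fun V W h => ?_) (h U U.2)
  exact Subtype.ext (Subtype.ext (congrArg (fun x => x.1) h))

theorem IsOpLike.mk_supersets_lt {B : Set (Set X)} {κ : Cardinal} (h : IsOpLike B κ) {U : Set X}
    (hU : U ∈ B) : #{V // V ∈ B ∧ U ⊆ V} < κ := by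
  refine lt_of_le_of_lt (mk_le_of_injective (f := fun V : {V // V ∈ B ∧ U ⊆ V} =>
    (⟨⟨V.1, V.2.1⟩, V.2.2⟩ : {V : B // ⟨U, hU⟩ ≤ V})) fun V W h => ?_) (h ⟨U, hU⟩)
  exact Subtype.ext (congrArg (fun x => x.1.1) h)

theorem noetherianType_pi_le {ι : Type} [Fintype ι] [TopologicalSpace X] :
    noetherianType (ι → X) ≤ noetherianType X := by
  obtain ⟨B, hB, hκ, hlike⟩ := exists_basis_isOpLike_noetherianType X
  let C : Set (Set (ι → X)) :=
    -- Nonempty factors make inclusion of boxes equivalent to factorwise inclusion.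
    {S | ∃ U : ι → Set X, (∀ i, U i ∈ B ∧ (U i).Nonempty) ∧ S = Set.univ.pi U}
  have hC : IsTopologicalBasis C := by
    refine isTopologicalBasis_of_isOpen_of_nhds ?_ fun x W hx hW => ?_
    · rintro _ ⟨U, hU, rfl⟩
      exact isOpen_set_pi Set.finite_univ fun i _ => hB.isOpen (hU i).1
    · obtain ⟨V, hV, hVW⟩ := isOpen_pi_iff'.1 hW x hx
      choose U hU hxU hUV using fun i => hB.exists_subset_of_mem_open (hV i).2 (hV i).1
      exact ⟨_, ⟨U, fun i => ⟨hU i, x i, hxU i⟩, rfl⟩, fun i _ => hxU i,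
        (Set.pi_mono fun i _ => hUV i).trans hVW⟩
  refine noetherianType_le hC hκ ?_
  rintro _ ⟨U, hU, rfl⟩
  have hne : (Set.univ.pi U).Nonempty := Set.univ_pi_nonempty_iff.2 fun i => (hU i).2
  have hsurj : {W | W ∈ C ∧ Set.univ.pi U ⊆ W} ⊆
      Set.range fun V : ∀ i, {V // V ∈ B ∧ U i ⊆ V} => Set.univ.pi fun i => (V i).1 := by
    rintro _ ⟨⟨V, hV, rfl⟩, hUV⟩
    have hUV' : ∀ i, U i ⊆ V i := fun i => by
      rcases Set.pi_subset_pi_iff.1 hUV with h | h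
      · exact h i (Set.mem_univ i)
      · exact absurd h hne.ne_empty
    exact ⟨fun i => ⟨V i, (hV i).1, hUV' i⟩, rfl⟩
  refine ((mk_le_mk_of_subset hsurj).trans mk_range_le).trans_lt ?_
  rw [mk_pi, prod_eq_of_fintype, lift_uzero]
  exact Finset.prod_induction _ (· < noetherianType X) (fun _ _ => mul_lt_of_lt hκ)
    (one_lt_aleph0.trans_le hκ) fun i _ => hlike.mk_supersets_lt (hU i).1

theorem noetherianType_le_pi {ι : Type} [Fintype ι] [Nonempty ι] [TopologicalSpace X]
    [CompactSpace X] [T2Space X] : noetherianType X ≤ noetherianType (ι → X) := by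
  obtain ⟨C, hC, hκ, hlike⟩ := exists_basis_isOpLike_noetherianType (ι → X)
  set κ := noetherianType (ι → X)
  let δ : X → ι → X := Function.const ι
  have hδ : Continuous δ := continuous_pi fun _ => continuous_id
  let r : Set X → Set (ι → X) → Prop := fun q e => Set.univ.pi (fun _ => q) ⊆ e
  have hr : ∀ e, IsOpen e → ∀ p, δ p ∈ e → ∃ q, IsOpen q ∧ p ∈ q ∧ r q e := by
    intro e he p hp
    obtain ⟨V, hV, hVe⟩ := isOpen_pi_iff'.1 he _ hp
    exact ⟨⋂ i, V i, isOpen_iInter_of_finite fun i => (hV i).1, Set.mem_iInter.2 fun i => (hV i).2,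
      (Set.pi_mono fun i _ => Set.iInter_subset V i).trans hVe⟩
  obtain ⟨S, hCS, -, Q, hQ, hfin, hserves⟩ := hasSupply (r := r) hC hδ hr C Set.finite_empty
  have hiso : ∀ p, IsOpen {δ p} → IsOpen {p} := fun p hp => by
    have := hp.preimage hδ
    rwa [show δ ⁻¹' {δ p} = {p} from Set.ext fun x => Function.const_inj] at this
  -- Supplies serve only points with nonisolated diagonal image, hence the added singletons.
  let A : Set (Set X) := {q | q.Nonempty ∧ ∃ e, (q, e) ∈ Q} ∪ {q | ∃ p, q = {p} ∧ IsOpen {p}}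
  have hA : IsTopologicalBasis A := by
    refine isTopologicalBasis_of_isOpen_of_nhds ?_ fun p V hp hV => ?_
    · rintro q (⟨-, e, he⟩ | ⟨p, rfl, hp⟩)
      · exact (hQ _ he).2.2.2.1
      · exact hp
    by_cases hi : IsOpen {δ p}
    · exact ⟨{p}, Or.inr ⟨p, rfl, hiso p hi⟩, rfl, by simpa using hp⟩
    obtain ⟨c, hc, hpc, hcV⟩ := hC.exists_subset_of_mem_open
      (show δ p ∈ Set.univ.pi fun _ => V from fun _ _ => hp)
      (isOpen_set_pi Set.finite_univ fun _ _ => hV)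
    obtain ⟨c', hc', hpc', hcl⟩ := hC.exists_closure_subset ((hC.isOpen hc).mem_nhds hpc)
    rcases hserves p hi c ⟨c', hCS hc', c, hCS hc, hC.isOpen hc', hC.isOpen hc, hpc', hcl,
      subset_rfl⟩ with ⟨N, hN, -⟩ | ⟨⟨q, e⟩, hx, hpq, hec⟩
    · exact absurd hN (Set.notMem_empty N)
    · refine ⟨q, Or.inl ⟨⟨p, hpq⟩, e, hx⟩, hpq, fun x hxq => ?_⟩
      obtain ⟨i⟩ := ‹Nonempty ι›
      exact hcV (hec ((hQ _ hx).2.2.2.2 (show δ x ∈ _ from fun _ _ => hxq))) i (Set.mem_univ i)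
  refine noetherianType_le hA hκ fun q hq => ?_
  have hqo : IsOpen q := hA.isOpen hq
  have hqne : q.Nonempty := by
    rcases hq with h | ⟨p, rfl, -⟩
    · exact h.1
    · exact Set.singleton_nonempty p
  obtain ⟨p, hp⟩ := hqne
  obtain ⟨c, hc, hpc, hcq⟩ := hC.exists_subset_of_mem_open
    (show δ p ∈ Set.univ.pi fun _ => q from fun _ _ => hp)
    (isOpen_set_pi Set.finite_univ fun _ _ => hqo)
  let E : Set (Set (ι → X)) := {e | e ∈ C ∧ c ⊆ e}
  have hE : #E < κ := hlike.mk_supersets_lt hc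
  have hsub : {q' | q' ∈ A ∧ q ⊆ q'} ⊆ insert {p} (⋃ e : E, {q' | (q', e.1) ∈ Q}) := by
    rintro q' ⟨⟨-, e, he⟩ | ⟨p', rfl, -⟩, hqq⟩
    · refine Or.inr (Set.mem_iUnion.2 ⟨⟨e, (hQ _ he).2.1, ?_⟩, he⟩)
      exact (hcq.trans (Set.pi_mono fun _ _ => hqq)).trans (hQ _ he).2.2.2.2
    · have : p = p' := hqq hp
      exact Or.inl (by rw [this])
  refine (mk_le_mk_of_subset hsub).trans_lt (mk_insert_le.trans_lt ?_)
  refine add_lt_of_lt hκ ?_ (one_lt_aleph0.trans_le hκ)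
  -- Finite fibres over `E` give a finite union or one of size at most `#E`, so `κ` need not be
  -- regular.
  rcases lt_or_ge #E ℵ₀ with hlt | hge
  · have : Finite E := lt_aleph0_iff_finite.1 hlt
    exact (lt_aleph0_iff_set_finite.2 (Set.finite_iUnion fun e : E => hfin e.1)).trans_le hκ
  · exact (mk_iUnion_le_of_le hge le_rfl fun e =>
      (lt_aleph0_iff_set_finite.2 (hfin e.1)).le.trans hge).trans_lt hE

/-- The Noetherian type of a compact Hausdorff space is preserved by nonempty finite powers. No
assumption on the weight is needed. -/
theorem noetherianType_pi_eq {ι : Type} [Fintype ι] [Nonempty ι] [TopologicalSpace X]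
    [CompactSpace X] [T2Space X] : noetherianType (ι → X) = noetherianType X :=
  noetherianType_pi_le.antisymm noetherianType_le_pi

end NoetherianType

theorem mainTheorem6 {X : Type*} [TopologicalSpace X] [CompactSpace X] [T2Space X]
    (hreg : (topWeight X).IsRegular) :
    (¬ MapsOntoCube X (topWeight X) →
      ∀ n : ℕ, 1 ≤ n → noetherianType (Fin n → X) = noetherianType X) ∧
    (HereditarilyNormal X ∨ ¬ ContainsBetaOmega X ∨ #X < 2 ^ topWeight X →
      ∀ n : ℕ, 1 ≤ n → noetherianType (Fin n → X) = noetherianType X) := by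
  have key : ∀ n : ℕ, 1 ≤ n → noetherianType (Fin n → X) = noetherianType X := fun n hn =>
    have : Nonempty (Fin n) := ⟨⟨0, hn⟩⟩
    noetherianType_pi_eq
  exact ⟨fun _ => key, fun _ => key⟩
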